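/- All spaces are topological spaces. A \emph{cover} of a space is a family of proper subsets of it whose union is the whole space; it is \emph{open} if its members are open. A \emph{$\gamma$-cover} is an infinite cover such that each point of the space belongs to all but finitely many of its members, and $\Gamma(X)$ is the family of open $\gamma$-covers of $X$. An \emph{$\omega$-cover} is an open cover such that each finite subset of the space is contained in a member of the cover. A space $X$ satisfies $\mathsf{S}_1(\Gamma,\Gamma)$ if for every sequence $\mathcal U_1,\mathcal U_2,\dots\in\Gamma(X)$ there are $U_n\in\mathcal U_n$ with $\{U_n : n\in\mathbb N\}\in\Gamma(X)$; it satisfies $\binom{\Omega}{\Gamma}$ (the Gerlits--Nagy property $\gamma$) if every $\omega$-cover of $X$ contains a $\gamma$-cover of $X$. A \emph{set of reals} is a space homeomorphic to a subset of $\mathbb R$; it is \emph{productively} $\mathsf{S}_1(\Gamma,\Gamma)$ if its product with every set of reals satisfying $\mathsf{S}_1(\Gamma,\Gamma)$ satisfies $\mathsf{S}_1(\Gamma,\Gamma)$. Let $[\mathbb N]^\infty$ be the family of infinite subsets of $\mathbb N$, identified with the strictly increasing functions $\mathbb N\to\mathbb N$ via increasing enumeration, and let $\mathrm{Fin}$ be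 the family of finite subsets of $\mathbb N$. For an uncountable ordinal $\kappa$, a set $X\subseteq[\mathbb N]^\infty$ with $|X|\ge\kappa$ is a \emph{$\kappa$-generalized tower} if for each $a\in[\mathbb N]^\infty$ there are $b\in[\mathbb N]^\infty$ and $S\subseteq X$ with $|S|<\kappa$ such that $x\cap\bigcup_{n\in b}[a(n),a(n+1))$ is finite for all $x\in X\setminus S$. (Cardinals are regarded as initial ordinals.) A \emph{$\kappa$-generalized tower set} is a set $X\cup\mathrm{Fin}$, where $X$ is a $\kappa$-generalized tower, with the topology inherited from $P(\mathbb N)\cong\{0,1\}^{\mathbb N}$. \textbf{Theorem.} Let $\kappa$ be an uncountable ordinal such that every set of reals of cardinality less than $\kappa$ is productively $\mathsf{S}_1(\Gamma,\Gamma)$. Then for all $\kappa$-generalized towers $X_1,\dots,X_m$ (where $m\ge 0$) and every set of reals $Y$ satisfying $\binom{\Omega}{\Gamma}$, the product space $(X_1\cup\mathrm{Fin})\times\dots\times(X_m\cup\mathrm{Fin})\times Y$ satisfies $\mathsf{S}_1(\Gamma,\Gamma)$. -/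

import Mathlib

open scoped Cardinal

namespace GenTower

section Covers

variable {X : Type*}

/-- A cover of a space: a family of proper subsets whose union is the whole space. -/
def IsCover (𝒰 : Set (Set X)) : Prop :=
  (∀ U ∈ 𝒰, U ≠ Set.univ) ∧ ⋃₀ 𝒰 = Set.univ

/-- A cover whose members are open. -/
def IsOpenCover [TopologicalSpace X] (𝒰 : Set (Set X)) : Prop :=
  IsCover 𝒰 ∧ ∀ U ∈ 𝒰, IsOpen U

variable (X)

/-- `Γ(X)`: the open `γ`-covers, that is, the infinite open covers such that each point
belongs to all but finitely many members. -/
def Gam [TopologicalSpace X] : Set (Set (Set X)) :=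
  {𝒰 | IsOpenCover 𝒰 ∧ 𝒰.Infinite ∧ ∀ x : X, {U | U ∈ 𝒰 ∧ x ∉ U}.Finite}

/-- `Ω(X)`: the `ω`-covers, that is, the open covers such that each finite subset of the space
is contained in a member. -/
def Om [TopologicalSpace X] : Set (Set (Set X)) :=
  {𝒰 | IsOpenCover 𝒰 ∧ ∀ F : Set X, F.Finite → ∃ U ∈ 𝒰, F ⊆ U}

variable {X}

/-- The selection principle `S₁(𝒜, ℬ)` for two families of covers of one space. -/
def SelOne (𝒜 ℬ : Set (Set (Set X))) : Prop :=
  ∀ 𝒰 : ℕ → Set (Set X), (∀ n, 𝒰 n ∈ 𝒜) →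
    ∃ U : ℕ → Set X, (∀ n, U n ∈ 𝒰 n) ∧ Set.range U ∈ ℬ

variable (X)

/-- The space `X` satisfies `S₁(Γ, Γ)`. -/
def SOneGamGam [TopologicalSpace X] : Prop :=
  SelOne (Gam X) (Gam X)

/-- The Gerlits–Nagy property `γ`: every `ω`-cover contains a `γ`-cover. -/
def GerlitsNagy [TopologicalSpace X] : Prop :=
  ∀ 𝒰 ∈ Om X, ∃ 𝒱 ⊆ 𝒰, 𝒱 ∈ Gam X

end Covers

/-- A set of reals: a space homeomorphic to a subset of the real line. -/
def IsSetOfReals (X : Type) [TopologicalSpace X] : Prop :=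
  ∃ A : Set ℝ, Nonempty (X ≃ₜ A)

/-- `X` is productively `S₁(Γ, Γ)` (in the realm of sets of reals): its product with every set of
reals satisfying `S₁(Γ, Γ)` satisfies `S₁(Γ, Γ)`. -/
def ProductivelySOneGamGam (X : Type) [TopologicalSpace X] : Prop :=
  ∀ (Z : Type) [TopologicalSpace Z], IsSetOfReals Z → SOneGamGam Z → SOneGamGam (X × Z)

/-- A `κ`-generalized tower: a family `X` of at least `κ` many infinite subsets of `ℕ` such that for
each `a` in `[ℕ]^∞`, viewed as a strictly increasing function, there are an infinite set `b` and a
subfamily `S` of cardinality less than `κ` such that each member of `X` outside `S` has finite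
intersection with the union of the intervals `[a(n), a(n+1))`, `n ∈ b`.
Cardinals are compared with the ordinal `κ` as initial ordinals. -/
def IsGeneralizedTower (κ : Ordinal.{0}) (X : Set (Set ℕ)) : Prop :=
  (∀ x ∈ X, x.Infinite) ∧ κ ≤ (#X).ord ∧
    ∀ a : ℕ → ℕ, StrictMono a →
      ∃ b : Set ℕ, b.Infinite ∧ ∃ S ⊆ X, (#S).ord < κ ∧
        ∀ x ∈ X \ S, (x ∩ ⋃ n ∈ b, Set.Ico (a n) (a (n + 1))).Finite

open Classical in
/-- The identification of `P(ℕ)` with the Cantor space `2^ℕ` via characteristic functions. -/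
noncomputable def toCantor (s : Set ℕ) : ℕ → Bool := fun n => decide (n ∈ s)

/-- The subset `X ∪ Fin` of `P(ℕ)`, as a subset of the Cantor space. As `X` runs over
the `κ`-generalized towers, these are the `κ`-generalized tower sets. -/
def towerSet (X : Set (Set ℕ)) : Set (ℕ → Bool) :=
  toCantor '' (X ∪ {s | s.Finite})

end GenTower

namespace GenTower

open Set Filter Topology

/-! Induct on the number of towers. Given an array `U n k`, the property of `Y` yields a fast
increasing `a` and columns `k j` such that, for each `y` and all large `j`, every `x` vanishing on
`[a j, a (j+1))` has `(x, y) ∈ U n (k j)` for all `n ≤ j` (`exists_strictMono_avoids_mem`). The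
tower property gives one infinite `b` and small sets `S i`: if no coordinate of `x` lies in its `S
i`, then `x` vanishes on almost all intervals indexed by `b`, and any late column from `b` serves.

The other points lie in finitely many continuous images of `S i × (the product without factor i)`.
Productivity and the induction hypothesis handle each piece, and the selections are combined by
`SelOn.union`. Productivity only concerns sets of reals, so `Y` must embed in a Cantor cube; it
does, having measure zero. -/

/-- The indexed form of `S₁(Γ, Γ)`: from every array of open sets whose rows converge pointwise one
can select a pointwise convergent sequence. -/
def SeqSelOne (Z : Type*) [TopologicalSpace Z] : Prop :=
  ∀ U : ℕ → ℕ → Set Z, (∀ n k, IsOpen (U n k)) → (∀ n z, ∀ᶠ k in atTop, z ∈ U n k) →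
    ∃ f : ℕ → ℕ, ∀ z, ∀ᶠ n in atTop, z ∈ U n (f n)

/-! ### Covers as families versus indexed sequences -/

theorem exists_injective_selection {α : Type*} (A : ℕ → Set α) (hA : ∀ n, (A n).Infinite) :
    ∃ g : ℕ → α, Function.Injective g ∧ ∀ n, g n ∈ A n := by
  classical
  -- With `n + 1` candidates for index `n`, Hall's condition follows from the largest index alone.
  choose t htA htc using fun n => (hA n).exists_subset_card_eq (n + 1)
  obtain ⟨g, hg, hgt⟩ := (Finset.all_card_le_biUnion_card_iff_exists_injective t).1 fun s => by
    rcases s.eq_empty_or_nonempty with rfl | hs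
    · simp
    · calc s.card ≤ (Finset.range (s.max' hs + 1)).card :=
            Finset.card_le_card fun i hi =>
              Finset.mem_range.2 (Nat.lt_succ_of_le (s.le_max' i hi))
        _ = (t (s.max' hs)).card := by rw [Finset.card_range, htc]
        _ ≤ _ := Finset.card_le_card (Finset.subset_biUnion_of_mem t (s.max'_mem hs))
  exact ⟨g, hg, fun n => htA n (hgt n)⟩

section

variable {Z : Type*}

theorem infinite_range_of_eventually_mem {U : ℕ → Set Z} (hU : ∀ n, U n ≠ univ)
    (h : ∀ z, ∀ᶠ n in atTop, z ∈ U n) : (range U).Infinite := by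
  intro hfin
  have : Finite (range U) := hfin
  obtain ⟨⟨V, m, rfl⟩, hV⟩ := Finite.exists_infinite_fiber (rangeFactorization U)
  obtain ⟨z, hz⟩ := (ne_univ_iff_exists_notMem _).1 (hU m)
  have hinf := Set.infinite_coe_iff.1 hV
  refine hinf ((Nat.cofinite_eq_atTop ▸ h z : ∀ᶠ n in cofinite, z ∈ U n).subset fun n hn => ?_)
  have hn' : U n = U m := congrArg Subtype.val hn
  simpa [hn'] using hz

theorem range_mem_gam [TopologicalSpace Z] {U : ℕ → Set Z} (hU : ∀ n, U n ≠ univ)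
    (ho : ∀ n, IsOpen (U n)) (h : ∀ z, ∀ᶠ n in atTop, z ∈ U n) : range U ∈ Gam Z := by
  refine ⟨⟨⟨?_, ?_⟩, ?_⟩, infinite_range_of_eventually_mem hU h, fun z => ?_⟩
  · rintro _ ⟨n, rfl⟩
    exact hU n
  · refine eq_univ_of_forall fun z => ?_
    obtain ⟨n, hn⟩ := (h z).exists
    exact ⟨U n, ⟨n, rfl⟩, hn⟩
  · rintro _ ⟨n, rfl⟩
    exact ho n
  · have hz : {n | z ∉ U n}.Finite := by
      rw [← Nat.cofinite_eq_atTop] at h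
      exact h z
    refine (hz.image U).subset ?_
    rintro _ ⟨⟨n, rfl⟩, hn⟩
    exact ⟨n, hn, rfl⟩

theorem eventually_mem_of_injective [TopologicalSpace Z] {𝒰 : Set (Set Z)} (h𝒰 : 𝒰 ∈ Gam Z)
    {u : ℕ → Set Z} (hu : Function.Injective u) (hmem : ∀ n, u n ∈ 𝒰) (z : Z) :
    ∀ᶠ n in atTop, z ∈ u n := by
  rw [← Nat.cofinite_eq_atTop]
  refine ((h𝒰.2.2 z).preimage hu.injOn).subset fun n hn => ⟨hmem n, hn⟩

theorem SeqSelOne.sOneGamGam [TopologicalSpace Z] (h : SeqSelOne Z) : SOneGamGam Z := by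
  intro 𝒰 h𝒰
  let u : ∀ n, ℕ ↪ 𝒰 n := fun n => (h𝒰 n).2.1.natEmbedding
  obtain ⟨f, hf⟩ := h (fun n k => u n k) (fun n k => (h𝒰 n).1.2 _ (u n k).2) fun n z =>
    eventually_mem_of_injective (h𝒰 n) (Subtype.val_injective.comp (u n).injective)
      (fun k => (u n k).2) z
  exact ⟨fun n => u n (f n), fun n => (u n (f n)).2,
    range_mem_gam (fun n => (h𝒰 n).1.1.1 _ (u n (f n)).2)
      (fun n => (h𝒰 n).1.2 _ (u n (f n)).2) hf⟩

/-- A selected family forgets its indexing and might repeat sets. Rows are first thinned to be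
pairwise disjoint families, so the selection is injective and "all but finitely many members" means
"eventually in `n`". -/
theorem SOneGamGam.seqSelOne [TopologicalSpace Z] (h : SOneGamGam Z) : SeqSelOne Z := by
  classical
  intro U hUo hU
  by_cases hall : ∀ n, ∃ k, U n k = univ
  · choose f hf using hall
    exact ⟨f, fun z => Eventually.of_forall fun n => by simp [hf]⟩
  obtain ⟨n₀, hn₀⟩ := not_forall.1 hall
  -- rows containing the whole space are replaced by a fixed proper row
  let r : ℕ → ℕ := fun n => if ∃ k, U n k = univ then n₀ else n
  have hr : ∀ n k, U (r n) k ≠ univ := fun n k hk => by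
    by_cases hn : ∃ k, U n k = univ
    · simp only [r, if_pos hn] at hk
      exact hn₀ ⟨k, hk⟩
    · simp only [r, if_neg hn] at hk
      exact hn ⟨k, hk⟩
  have hgam : ∀ n, range (U (r n)) ∈ Gam Z := fun n =>
    range_mem_gam (hr n) (hUo _) (hU _)
  obtain ⟨g, hginj, hg⟩ := exists_injective_selection (fun s => range (U (r s.unpair.1)))
    fun s => (hgam _).2.1
  have hginj' : ∀ n, Function.Injective fun k => g (Nat.pair n k) := fun n k l hkl =>
    (Nat.pair_eq_pair.1 (hginj hkl)).2
  have hg' : ∀ n k, g (Nat.pair n k) ∈ range (U (r n)) := fun n k => by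
    simpa using hg (Nat.pair n k)
  obtain ⟨W, hW, hWgam⟩ := h (fun n => range fun k => g (Nat.pair n k)) fun n =>
    range_mem_gam (fun k => (hgam n).1.1.1 _ (hg' n k)) (fun k => (hgam n).1.2 _ (hg' n k))
      (eventually_mem_of_injective (hgam n) (hginj' n) (hg' n))
  have hWinj : Function.Injective W := fun n l hnl => by
    obtain ⟨k, hk⟩ := hW n
    obtain ⟨k', hk'⟩ := hW l
    exact (Nat.pair_eq_pair.1 (hginj (hk.trans (hnl.trans hk'.symm)))).1
  have hsel : ∀ n, ∃ k, W n ⊆ U n k := fun n => by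
    by_cases hn : ∃ k, U n k = univ
    · obtain ⟨k, hk⟩ := hn
      exact ⟨k, by simp [hk]⟩
    · obtain ⟨k, hk⟩ := hW n
      obtain ⟨l, hl⟩ := hg' n k
      simp only [r, if_neg hn] at hl
      exact ⟨l, by rw [hl, ← hk]⟩
  choose f hf using hsel
  exact ⟨f, fun z =>
    (eventually_mem_of_injective hWgam hWinj mem_range_self z).mono fun n hn => hf n hn⟩

/-! ### Selection on pieces of a space -/

/-- Selection for the points of a subset of a space, with infinitely many choices in each row. -/
def SelOn {T : Type*} [TopologicalSpace T] (B : Set T) : Prop :=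
  ∀ U : ℕ → ℕ → Set T, (∀ n k, IsOpen (U n k)) → (∀ n, ∀ z ∈ B, ∀ᶠ k in atTop, z ∈ U n k) →
    ∃ f : ℕ → ℕ → ℕ, (∀ n, Tendsto (f n) atTop atTop) ∧
      ∀ z ∈ B, ∀ᶠ n in atTop, ∀ l, z ∈ U n (f n l)

theorem SeqSelOne.selOn_range [TopologicalSpace Z] (h : SeqSelOne Z) {T : Type*}
    [TopologicalSpace T] {g : Z → T} (hg : Continuous g) : SelOn (range g) := by
  intro U hUo hU
  -- Each row is repeated infinitely often; the shift by the copy number forces the chosen columns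
  -- to infinity.
  obtain ⟨f, hf⟩ := h (fun s k => g ⁻¹' U s.unpair.1 (k + s.unpair.2))
    (fun s k => (hUo _ _).preimage hg) fun s z =>
      (tendsto_add_atTop_nat s.unpair.2).eventually (hU s.unpair.1 (g z) ⟨z, rfl⟩)
  refine ⟨fun n l => f (Nat.pair n l) + l, fun n => ?_, ?_⟩
  · exact tendsto_atTop_mono (fun l => Nat.le_add_left l _) tendsto_id
  · rintro _ ⟨z, rfl⟩
    obtain ⟨N, hN⟩ := eventually_atTop.1 (hf z)
    filter_upwards [eventually_ge_atTop N] with n hn l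
    simpa using hN (Nat.pair n l) (hn.trans (Nat.left_le_pair n l))

theorem selOn_empty {T : Type*} [TopologicalSpace T] : SelOn (∅ : Set T) := fun _ _ _ =>
  ⟨fun _ l => l, fun _ => tendsto_id, fun _ hz => hz.elim⟩

/-- The second selection is made among columns allowed by the first, which is valid for every `l`.
-/
theorem SelOn.union {T : Type*} [TopologicalSpace T] {B C : Set T} (hB : SelOn B)
    (hC : SelOn C) : SelOn (B ∪ C) := by
  intro U hUo hU
  obtain ⟨f, hft, hf⟩ := hB U hUo fun n z hz => hU n z (Or.inl hz)
  obtain ⟨g, hgt, hg⟩ := hC (fun n l => U n (f n l)) (fun _ _ => hUo _ _) fun n z hz =>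
    (hft n).eventually (hU n z (Or.inr hz))
  refine ⟨fun n l => f n (g n l), fun n => (hft n).comp (hgt n), ?_⟩
  rintro z (hz | hz)
  · exact (hf z hz).mono fun n hn l => hn _
  · exact hg z hz

theorem selOn_biUnion {T ι : Type*} [TopologicalSpace T] (s : Finset ι) {B : ι → Set T}
    (hB : ∀ i ∈ s, SelOn (B i)) : SelOn (⋃ i ∈ s, B i) := by
  classical
  induction s using Finset.induction_on with
  | empty => simpa using selOn_empty
  | insert i s _ ih =>
    rw [Finset.set_biUnion_insert]
    exact (hB i (Finset.mem_insert_self i s)).union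
      (ih fun j hj => hB j (Finset.mem_insert_of_mem hj))

end

/-! ### Selection from the Gerlits–Nagy property -/

theorem GerlitsNagy.exists_selection {Y : Type*} [TopologicalSpace Y] [T1Space Y]
    (hY : GerlitsNagy Y) (𝒢 : ℕ → Set (Set Y)) (ho : ∀ n, ∀ G ∈ 𝒢 n, IsOpen G)
    (hω : ∀ n, ∀ F : Set Y, F.Finite → ∃ G ∈ 𝒢 n, F ⊆ G) :
    ∃ φ : ℕ → ℕ, StrictMono φ ∧ ∃ G : ℕ → Set Y, (∀ j, G j ∈ 𝒢 (φ j)) ∧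
      ∀ y, ∀ᶠ j in atTop, y ∈ G j := by
  rcases finite_or_infinite Y with hfin | hinf
  · choose G hG hsub using fun n => hω n univ (toFinite _)
    exact ⟨id, strictMono_id, G, hG, fun y => Eventually.of_forall fun j => hsub j trivial⟩
  let e := Infinite.natEmbedding Y
  -- Deleting `e n` from the members of `𝒢 n` lets a `γ`-subcover use only finitely many of them,
  -- hence infinitely many `n`.
  have hOm : {V | ∃ n, ∃ G ∈ 𝒢 n, V = G \ {e n}} ∈ Om Y := by
    have key : ∀ F : Set Y, F.Finite → ∃ V ∈ {V | ∃ n, ∃ G ∈ 𝒢 n, V = G \ {e n}}, F ⊆ V := by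
      intro F hF
      obtain ⟨n, hn⟩ := (hF.preimage e.injective.injOn).exists_notMem
      obtain ⟨G, hG, hFG⟩ := hω n F hF
      refine ⟨_, ⟨n, G, hG, rfl⟩, fun y hy => ⟨hFG hy, ?_⟩⟩
      rintro rfl
      exact hn hy
    refine ⟨⟨⟨?_, ?_⟩, ?_⟩, key⟩
    · rintro _ ⟨n, G, _, rfl⟩ h
      have : e n ∈ G \ {e n} := h ▸ mem_univ _
      exact this.2 rfl
    · refine eq_univ_of_forall fun y => ?_
      obtain ⟨V, hV, hy⟩ := key {y} (finite_singleton y)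
      exact ⟨V, hV, hy rfl⟩
    · rintro _ ⟨n, G, hG, rfl⟩
      exact (ho n G hG).sdiff isClosed_singleton
  obtain ⟨𝒱, h𝒱, hgam⟩ := hY _ hOm
  choose ν G hG hVG using fun V : 𝒱 => h𝒱 V.2
  have hfib : ∀ n, {V : 𝒱 | ν V = n}.Finite := fun n => by
    refine ((hgam.2.2 (e n)).preimage Subtype.val_injective.injOn).subset ?_
    rintro V rfl
    refine ⟨V.2, fun h => ?_⟩
    rw [hVG V] at h
    exact h.2 rfl
  have hinf𝒱 : Infinite 𝒱 := hgam.2.1.to_subtype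
  have hN : (range ν).Infinite := fun hfin => by
    have : (⋃ n ∈ range ν, {V : 𝒱 | ν V = n}).Finite := hfin.biUnion fun n _ => hfib n
    exact infinite_univ (this.subset fun V _ => mem_biUnion (mem_range_self V) rfl)
  have : Infinite (range ν) := hN.to_subtype
  classical
  let φ : ℕ ↪o ℕ := Nat.orderEmbeddingOfSet (range ν)
  have hφ : ∀ j, φ j ∈ range ν := fun j => (Nat.orderEmbeddingOfSet_range _).subset ⟨j, rfl⟩
  choose V hV using hφ
  refine ⟨φ, φ.strictMono, fun j => G (V j), fun j => hV j ▸ hG (V j), fun y => ?_⟩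
  have hVinj : Function.Injective fun j => (V j : Set Y) := fun i j hij =>
    φ.injective (by rw [← hV i, ← hV j, Subtype.val_injective hij])
  refine (eventually_mem_of_injective hgam hVinj (fun j => (V j).2) y).mono fun j hj => ?_
  rw [hVG (V j)] at hj
  exact hj.1

/-! ### Intervals missed by towers -/

/-- A generalized tower admits the set `b` inside any prescribed infinite set. -/
theorem IsGeneralizedTower.exists_subset {κ : Ordinal.{0}} {X : Set (Set ℕ)}
    (hX : IsGeneralizedTower κ X) {a : ℕ → ℕ} (ha : StrictMono a) {b : Set ℕ} (hb : b.Infinite) :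
    ∃ c ⊆ b, c.Infinite ∧ ∃ S ⊆ X, (#S).ord < κ ∧
      ∀ x ∈ X \ S, (x ∩ ⋃ n ∈ c, Ico (a n) (a (n + 1))).Finite := by
  classical
  have : Infinite b := hb.to_subtype
  let β : ℕ ↪o ℕ := Nat.orderEmbeddingOfSet b
  -- Each coarse interval of `a ∘ β` contains the original interval starting at the same point.
  obtain ⟨c, hc, S, hS, hcard, hfin⟩ := hX.2.2 (a ∘ β) (ha.comp β.strictMono)
  refine ⟨β '' c, ?_, hc.image β.injective.injOn, S, hS, hcard, fun x hx =>
    (hfin x hx).subset (inter_subset_inter_right _ ?_)⟩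
  · rintro _ ⟨n, _, rfl⟩
    exact (Nat.orderEmbeddingOfSet_range _).subset ⟨n, rfl⟩
  · simp only [mem_image, iUnion_exists, biUnion_and', iUnion_iUnion_eq_right]
    refine iUnion₂_mono fun n _ => Ico_subset_Ico_right (ha.monotone ?_)
    exact β.strictMono (Nat.lt_succ_self n)

theorem exists_common_set {κ : Ordinal.{0}} {ι : Type*} (s : Finset ι) {X : ι → Set (Set ℕ)}
    (hX : ∀ i, IsGeneralizedTower κ (X i)) {a : ℕ → ℕ} (ha : StrictMono a) :
    ∃ b : Set ℕ, b.Infinite ∧ ∀ i ∈ s, ∃ S ⊆ X i, (#S).ord < κ ∧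
      ∀ x ∈ X i \ S, (x ∩ ⋃ n ∈ b, Ico (a n) (a (n + 1))).Finite := by
  classical
  induction s using Finset.induction_on with
  | empty => exact ⟨univ, infinite_univ, by simp⟩
  | insert i s _ ih =>
    obtain ⟨b, hb, hbs⟩ := ih
    obtain ⟨c, hcb, hc, hci⟩ := (hX i).exists_subset ha hb
    refine ⟨c, hc, fun j hj => ?_⟩
    rcases Finset.mem_insert.1 hj with rfl | hj
    · exact hci
    · obtain ⟨S, hS, hcard, hfin⟩ := hbs j hj
      exact ⟨S, hS, hcard, fun x hx => (hfin x hx).subset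
        (inter_subset_inter_right _ (biUnion_subset_biUnion_left hcb))⟩

theorem exists_forall_notMem_Ico {a : ℕ → ℕ} (ha : StrictMono a) {b x : Set ℕ}
    (h : (x ∩ ⋃ n ∈ b, Ico (a n) (a (n + 1))).Finite) :
    ∃ N, ∀ n ∈ b, N ≤ n → ∀ e ∈ x, e ∉ Ico (a n) (a (n + 1)) := by
  obtain ⟨M, hM⟩ := h.bddAbove
  refine ⟨M + 1, fun n hn hMn e he hea => ?_⟩
  have h1 : e ≤ M := hM ⟨he, mem_biUnion hn hea⟩
  have h2 := ha.le_apply (x := n)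
  have h3 := hea.1
  omega

/-! ### Tubes over points avoiding an interval -/

section

variable {ι : Type*} {X : ι → Set (Set ℕ)} {Y : Type*} [TopologicalSpace Y]

theorem exists_forall_agree_mem {A : ι → Set (ℕ → Bool)} {x₀ : ∀ i, A i} {s : Set (∀ i, A i)}
    (hs : s ∈ 𝓝 x₀) :
    ∃ c : ℕ, ∀ x : ∀ i, A i, (∀ i, ∀ j < c, (x i).1 j = (x₀ i).1 j) → x ∈ s := by
  let C : ℕ → Set (∀ i, A i) := fun c => {x | ∀ i, ∀ j < c, (x i).1 j = (x₀ i).1 j}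
  have hanti : Antitone C := fun c d hcd x hx i j hj => hx i j (hj.trans_le hcd)
  have hle : (⨅ c, 𝓟 (C c)) ≤ 𝓝 x₀ := by
    refine tendsto_id'.1 (tendsto_pi_nhds.2 fun i => tendsto_subtype_rng.2
      (tendsto_pi_nhds.2 fun j => ?_))
    rw [nhds_discrete, tendsto_pure]
    exact mem_iInf_of_mem (j + 1) (mem_principal.2 fun x hx => hx i j j.lt_succ_self)
  have hbasis := hasBasis_iInf_principal
    (directed_of_isDirected_le (r := (· ≥ ·)) hanti)
  obtain ⟨c, -, hc⟩ := hbasis.mem_iff.1 (hle hs)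
  exact ⟨c, fun x hx => hc hx⟩

/-- The points all of whose coordinates vanish on the interval `[a, a')`. -/
def Avoids (a a' : ℕ) (x : ∀ i, towerSet (X i)) : Prop :=
  ∀ i, ∀ j ∈ Ico a a', (x i).1 j = false

theorem truncate_mem_towerSet (Z : Set (Set ℕ)) (a : ℕ) (t : Fin a → Bool) :
    (fun j => if h : j < a then t ⟨j, h⟩ else false) ∈ towerSet Z := by
  refine ⟨{j | ∃ h : j < a, t ⟨j, h⟩ = true}, Or.inr ?_, ?_⟩
  · exact (finite_lt_nat a).subset fun j hj => hj.1
  · funext j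
    by_cases h : j < a <;> simp [toCantor, h]

/-- The point of the product of tower sets with prescribed coordinates below `a`, and zero above. -/
def finPoint (X : ι → Set (Set ℕ)) (a : ℕ) (t : ι → Fin a → Bool) (i : ι) : towerSet (X i) :=
  ⟨_, truncate_mem_towerSet (X i) a (t i)⟩

theorem Avoids.agree_finPoint {a a' : ℕ} {x : ∀ i, towerSet (X i)} (hx : Avoids a a' x) (i : ι)
    (j : ℕ) (hj : j < a') :
    (x i).1 j = (finPoint X a (fun i j => (x i).1 j) i).1 j := by
  by_cases h : j < a
  · simp [finPoint, h]
  · simp [finPoint, h, hx i j ⟨not_lt.1 h, hj⟩]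

/-- The interior of the set of points `y` such that all the points above `y` that avoid `[a, a')`
belong to the sets `U 0 k, …, U a k`. -/
def tubeBase (U : ℕ → ℕ → Set ((∀ i, towerSet (X i)) × Y)) (a k a' : ℕ) : Set Y :=
  interior {y | ∀ x, Avoids a a' x → ∀ n ≤ a, (x, y) ∈ U n k}

/-- Only finitely many `finPoint X a t` exist, so one column `k` serves them all over `F`. A point
avoiding `[a, a')` agrees below `a'` with one of them, so openness supplies `a'`. -/
theorem exists_subset_tubeBase [Finite ι] {U : ℕ → ℕ → Set ((∀ i, towerSet (X i)) × Y)}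
    (hUo : ∀ n k, IsOpen (U n k)) (hU : ∀ n z, ∀ᶠ k in atTop, z ∈ U n k) (a : ℕ) {F : Set Y}
    (hF : F.Finite) : ∃ k ≥ a, ∃ a' > a, F ⊆ tubeBase U a k a' := by
  have h1 : ∀ᶠ k in atTop, ∀ y ∈ F, ∀ t, ∀ n ∈ {n | n ≤ a}, (finPoint X a t, y) ∈ U n k :=
    (eventually_all_finite hF).2 fun y _ => eventually_all.2 fun t =>
      (eventually_all_finite (finite_le_nat a)).2 fun n _ => hU n _
  obtain ⟨k, hk, hka⟩ := (h1.and (eventually_ge_atTop a)).exists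
  have h2 : ∀ᶠ c in atTop, ∀ y ∈ F, ∀ t, ∀ᶠ y' in 𝓝 y, ∀ x : ∀ i, towerSet (X i),
      (∀ i, ∀ j < c, (x i).1 j = (finPoint X a t i).1 j) → ∀ n ≤ a, (x, y') ∈ U n k := by
    refine (eventually_all_finite hF).2 fun y hy => eventually_all.2 fun t => ?_
    have hW : {p | ∀ n ∈ {n | n ≤ a}, p ∈ U n k} ∈ 𝓝 (finPoint X a t, y) :=
      (eventually_all_finite (finite_le_nat a)).2 fun n hn =>
        (hUo n k).mem_nhds (hk y hy t n hn)
    obtain ⟨s, hs, V, hV, hsV⟩ := mem_nhds_prod_iff.1 hW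
    obtain ⟨c, hc⟩ := exists_forall_agree_mem hs
    filter_upwards [eventually_ge_atTop c] with d hd
    filter_upwards [hV] with y' hy' x hx n hn
    exact hsV (mk_mem_prod (hc x fun i j hj => hx i j (hj.trans_le hd)) hy') n hn
  obtain ⟨a', ha', haa'⟩ := (h2.and (eventually_gt_atTop a)).exists
  refine ⟨k, hka, a', haa', fun y hy => mem_interior_iff_mem_nhds.2 ?_⟩
  filter_upwards [eventually_all.2 (ha' y hy)] with y' hy' x hx
  exact hy' _ x hx.agree_finPoint

theorem exists_strictMono_avoids_mem [Finite ι] [T1Space Y] (hY : GerlitsNagy Y)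
    {U : ℕ → ℕ → Set ((∀ i, towerSet (X i)) × Y)} (hUo : ∀ n k, IsOpen (U n k))
    (hU : ∀ n z, ∀ᶠ k in atTop, z ∈ U n k) :
    ∃ a : ℕ → ℕ, StrictMono a ∧ ∃ k : ℕ → ℕ, (∀ j, j ≤ k j) ∧ ∀ y, ∀ᶠ j in atTop,
      ∀ x, Avoids (a j) (a (j + 1)) x → ∀ n ≤ j, (x, y) ∈ U n (k j) := by
  obtain ⟨φ, hφ, G, hG, hGy⟩ := hY.exists_selection
    (fun a => {G | ∃ k ≥ a, ∃ a' > a, G = tubeBase U a k a'})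
    (by rintro a _ ⟨k, _, a', _, rfl⟩; exact isOpen_interior)
    (fun a F hF => by
      obtain ⟨k, hk, a', ha', hsub⟩ := exists_subset_tubeBase hUo hU a hF
      exact ⟨_, ⟨k, hk, a', ha', rfl⟩, hsub⟩)
  choose k hk a' ha' hGeq using hG
  -- Sparse enough that `[φ (s i), φ (s (i+1)))` contains the interval `[φ (s i), a' (s i))` of the
  -- tube.
  let s : ℕ → ℕ := fun i => Nat.rec 0 (fun _ r => max (r + 1) (a' r)) i
  have hs : StrictMono s := strictMono_nat_of_lt_succ fun i => le_max_left (s i + 1) (a' (s i))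
  have hsa : ∀ i, a' (s i) ≤ φ (s (i + 1)) := fun i =>
    (le_max_right (s i + 1) (a' (s i))).trans hφ.le_apply
  have hle : ∀ i, i ≤ φ (s i) := fun i => (hφ.comp hs).le_apply
  refine ⟨φ ∘ s, hφ.comp hs, k ∘ s, fun i => (hle i).trans (hk (s i)), fun y => ?_⟩
  filter_upwards [hs.tendsto_atTop.eventually (hGy y)] with i hi x hx n hn
  rw [hGeq] at hi
  exact interior_subset hi x (fun l j hj => hx l j ⟨hj.1, hj.2.trans_le (hsa i)⟩) n
    (hn.trans (hle i))

theorem exists_forall_Ico_eq_false {Z S : Set (Set ℕ)} {a : ℕ → ℕ} (ha : StrictMono a)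
    {b : Set ℕ} (h : ∀ x ∈ Z \ S, (x ∩ ⋃ n ∈ b, Ico (a n) (a (n + 1))).Finite) {c : ℕ → Bool}
    (hc : c ∈ towerSet Z) (hcS : c ∉ toCantor '' S) :
    ∃ N, ∀ n ∈ b, N ≤ n → ∀ j ∈ Ico (a n) (a (n + 1)), c j = false := by
  obtain ⟨x, hx, rfl⟩ := hc
  have hfin : (x ∩ ⋃ n ∈ b, Ico (a n) (a (n + 1))).Finite := by
    rcases hx with hx | hx
    · exact h x ⟨hx, fun hxS => hcS ⟨x, hxS, rfl⟩⟩
    · exact Set.Finite.inter_of_left hx _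
  obtain ⟨N, hN⟩ := exists_forall_notMem_Ico ha hfin
  exact ⟨N, fun n hn hNn j hj => by
    simpa [toCantor] using fun hjx => hN n hn hNn j hjx hj⟩

theorem seqSelOne_of_selOn [Fintype ι] [T1Space Y] {κ : Ordinal.{0}}
    (hX : ∀ i, IsGeneralizedTower κ (X i)) (hY : GerlitsNagy Y)
    (hB : ∀ i, ∀ S ⊆ X i, (#S).ord < κ →
      SelOn {p : (∀ i, towerSet (X i)) × Y | (p.1 i : ℕ → Bool) ∈ toCantor '' S}) :
    SeqSelOne ((∀ i, towerSet (X i)) × Y) := by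
  classical
  intro U hUo hU
  obtain ⟨a, ha, k, hk, hgood⟩ := exists_strictMono_avoids_mem hY hUo hU
  obtain ⟨b, hb, hbS⟩ := exists_common_set Finset.univ hX ha
  choose S hSX hScard hfin using fun i => hbS i (Finset.mem_univ i)
  have : Infinite b := hb.to_subtype
  let β : ℕ ↪o ℕ := Nat.orderEmbeddingOfSet b
  have hβ : ∀ j, β j ∈ b := fun j => (Nat.orderEmbeddingOfSet_range b).subset ⟨j, rfl⟩
  have hβle : ∀ j, j ≤ β j := fun j => β.strictMono.le_apply
  have ht : ∀ n, Tendsto (fun l => k (β (n + l))) atTop atTop := fun n =>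
    tendsto_atTop_mono
      (fun l => (Nat.le_add_left l n).trans ((hβle _).trans (hk _))) tendsto_id
  -- Row `n` is restricted to columns `k (β (n + l))`: whichever is chosen, its index is at least
  -- `n` and in `b`, as the remaining points require.
  obtain ⟨f, -, hf⟩ := selOn_biUnion Finset.univ (fun i _ => hB i (S i) (hSX i) (hScard i))
    (fun n l => U n (k (β (n + l)))) (fun _ _ => hUo _ _)
    fun n z _ => (ht n).eventually (hU n z)
  refine ⟨fun n => k (β (n + f n 0)), fun p => ?_⟩
  by_cases hp : ∃ i, (p.1 i : ℕ → Bool) ∈ toCantor '' S i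
  · obtain ⟨i, hi⟩ := hp
    exact (hf p (mem_biUnion (Finset.mem_univ i) hi)).mono fun n hn => hn 0
  · have hN := fun i =>
      exists_forall_Ico_eq_false ha (hfin i) (p.1 i).2 (not_exists.1 hp i)
    choose N hN using hN
    obtain ⟨M, hM⟩ := eventually_atTop.1 (hgood p.2)
    filter_upwards [eventually_ge_atTop M,
      eventually_all.2 fun i => eventually_ge_atTop (N i)] with n hn hnN
    have hnβ : n ≤ β (n + f n 0) := (Nat.le_add_right n _).trans (hβle _)
    exact hM _ (hn.trans hnβ) p.1 (fun i => hN i _ (hβ _) ((hnN i).trans hnβ)) n hnβ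

end

/-! ### The product is a set of reals -/

section Reals

open MeasureTheory

theorem isSetOfReals_of_isEmbedding {Z : Type} [TopologicalSpace Z] {ι : Type*} [Countable ι]
    [Nonempty ι] {e : Z → ι → Bool} (he : IsEmbedding e) : IsSetOfReals Z := by
  obtain ⟨s, hs⟩ := exists_surjective_nat ι
  obtain ⟨r, hr⟩ := hs.hasRightInverse
  have h1 : IsEmbedding fun (c : ι → Bool) (n : ℕ) => c (s n) :=
    Function.LeftInverse.isEmbedding (f := fun (d : ℕ → Bool) i => d (r i))
      (fun c => funext fun i => by simp [hr i]) (by fun_prop) (by fun_prop)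
  have h := (IsEmbedding.subtypeVal.comp cantorSetHomeomorphNatToBool.symm.isEmbedding).comp
    (h1.comp he)
  exact ⟨_, ⟨h.toHomeomorph⟩⟩

/-- Borel–Cantelli: finite sets have open neighbourhoods of measure at most `2⁻ⁿ`, and selected ones
eventually contain each point. -/
theorem GerlitsNagy.volume_range_eq_zero {Y : Type*} [TopologicalSpace Y] [T1Space Y]
    (hY : GerlitsNagy Y) {f : Y → ℝ} (hf : Continuous f) : volume (range f) = 0 := by
  obtain ⟨φ, hφ, G, hG, hGy⟩ := hY.exists_selection
    (fun n => {G | ∃ O, IsOpen O ∧ volume O ≤ (2⁻¹ : ENNReal) ^ n ∧ G = f ⁻¹' O})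
    (by rintro n _ ⟨O, hO, _, rfl⟩; exact hO.preimage hf)
    (fun n F hF => by
      have hpos : volume (f '' F) < (2⁻¹ : ENNReal) ^ n := by
        rw [(hF.image f).measure_zero]
        exact ENNReal.pow_pos (by simp) n
      obtain ⟨O, hFO, hO, hlt⟩ := (f '' F).exists_isOpen_lt_of_lt _ hpos
      exact ⟨_, ⟨O, hO, hlt.le, rfl⟩, image_subset_iff.1 hFO⟩)
  choose O hO hOle hGO using hG
  have hsum : ∑' j, volume (O j) ≠ ⊤ := by
    refine ne_top_of_le_ne_top (b := ∑' j : ℕ, (2⁻¹ : ENNReal) ^ j) ?_ (ENNReal.tsum_le_tsum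
      fun j => (hOle j).trans (pow_le_pow_right_of_le_one' (by simp) hφ.le_apply))
    rw [ENNReal.tsum_geometric, ENNReal.one_sub_inv_two]
    simp
  refine measure_mono_null ?_ (ae_eventually_notMem hsum)
  rintro _ ⟨y, rfl⟩ hev
  obtain ⟨j, hj, hj'⟩ := ((hGy y).and hev).exists
  rw [hGO] at hj
  exact hj' hj

/-- Cuts at a countable dense set disjoint from the range are clopen and determine the topology. -/
theorem exists_isEmbedding_bool {Y : Type*} [TopologicalSpace Y] {f : Y → ℝ}
    (hf : IsEmbedding f) (hd : Dense (range f)ᶜ) :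
    ∃ D : Set ℝ, D.Countable ∧ D.Nonempty ∧ ∃ e : Y → D → Bool, IsEmbedding e := by
  obtain ⟨D, hDf, hDc, hD⟩ := hd.exists_countable_dense_subset
  refine ⟨D, hDc, hD.nonempty, fun y d => decide ((d : ℝ) < f y), ?_⟩
  have hcont : Continuous fun (y : Y) (d : D) => decide ((d : ℝ) < f y) := by
    refine continuous_pi fun d => (continuous_bool_rng true).2 ?_
    have h1 : (fun y => decide ((d : ℝ) < f y)) ⁻¹' {true} = f ⁻¹' Ioi (d : ℝ) := by
      ext y; simp
    have h2 : f ⁻¹' Ioi (d : ℝ) = f ⁻¹' Ici (d : ℝ) := by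
      ext y
      have : (d : ℝ) ≠ f y := fun h => hDf d.2 ⟨y, h.symm⟩
      exact ⟨fun h => mem_preimage.2 (mem_Ici.2 (mem_Ioi.1 (mem_preimage.1 h)).le),
        fun h => mem_preimage.2 (mem_Ioi.2 (lt_of_le_of_ne (mem_Ici.1 (mem_preimage.1 h)) this))⟩
    rw [h1]
    exact ⟨h2 ▸ isClosed_Ici.preimage hf.continuous, isOpen_Ioi.preimage hf.continuous⟩
  refine ⟨isInducing_iff_nhds.2 fun y => le_antisymm (hcont.tendsto y).le_comap ?_, ?_⟩
  · intro s hs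
    rw [hf.isInducing.nhds_eq_comap] at hs
    obtain ⟨t, ht, hts⟩ := hs
    obtain ⟨p, q, ⟨hp, hq⟩, hpq⟩ := mem_nhds_iff_exists_Ioo_subset.1 ht
    obtain ⟨d, hdD, hd⟩ := hD.exists_between hp
    obtain ⟨d', hdD', hd'⟩ := hD.exists_between hq
    refine ⟨{c | c ⟨d, hdD⟩ = true ∧ c ⟨d', hdD'⟩ = false}, ?_, ?_⟩
    · have hopen (i : D) (v : Bool) : IsOpen {c : D → Bool | c i = v} :=
        ((isClopen_discrete {v}).preimage (continuous_apply (A := fun _ : D => Bool) i)).isOpen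
      exact ((hopen _ _).inter (hopen _ _)).mem_nhds ⟨by simpa using hd.2, by simpa using hd'.1.le⟩
    · rintro z ⟨hz, hz'⟩
      have hz1 : d < f z := by simpa using hz
      have hz2 : f z ≤ d' := by simpa using hz'
      exact hts (hpq ⟨hd.1.trans hz1, hz2.trans_lt hd'.2⟩)
  · refine fun y z hyz => hf.injective (by_contra fun hne => ?_)
    rcases lt_or_gt_of_ne hne with h | h
    · obtain ⟨d, hdD, hd⟩ := hD.exists_between h
      have := congrFun hyz ⟨d, hdD⟩
      simp [hd.2] at this
      exact absurd hd.1 (not_lt.2 this.le)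
    · obtain ⟨d, hdD, hd⟩ := hD.exists_between h
      have := congrFun hyz ⟨d, hdD⟩
      simp [hd.2] at this
      exact absurd hd.1 (not_lt.2 this.le)

theorem IsSetOfReals.exists_isEmbedding {Y : Type} [TopologicalSpace Y] (hY : IsSetOfReals Y) :
    ∃ f : Y → ℝ, IsEmbedding f := by
  obtain ⟨A, ⟨h⟩⟩ := hY
  exact ⟨_, IsEmbedding.subtypeVal.comp h.isEmbedding⟩

theorem isSetOfReals_subtype_cantor (A : Set (ℕ → Bool)) : IsSetOfReals A :=
  isSetOfReals_of_isEmbedding IsEmbedding.subtypeVal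

theorem isSetOfReals_pi_prod {ι : Type} [Countable ι] (A : ι → Set (ℕ → Bool)) {Y : Type}
    [TopologicalSpace Y] (hYreal : IsSetOfReals Y) (hY : GerlitsNagy Y) :
    IsSetOfReals ((∀ i, A i) × Y) := by
  obtain ⟨f, hf⟩ := hYreal.exists_isEmbedding
  have : T1Space Y := hf.t1Space
  obtain ⟨D, hDc, hDn, e, he⟩ := exists_isEmbedding_bool hf
    (interior_eq_empty_iff_dense_compl.1
      (volume.interior_eq_empty_of_null (hY.volume_range_eq_zero hf.continuous)))
  have : Countable D := hDc.to_subtype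
  have : Nonempty D := hDn.to_subtype
  have h1 : IsEmbedding fun (q : (ι → ℕ → Bool) × (D → Bool)) (s : (ι × ℕ) ⊕ D) =>
      Sum.elim (fun t => q.1 t.1 t.2) q.2 s :=
    Function.LeftInverse.isEmbedding
      (f := fun (c : (ι × ℕ) ⊕ D → Bool) => (fun i n => c (.inl (i, n)), fun d => c (.inr d)))
      (fun _ => rfl) (by fun_prop)
      (continuous_pi fun s => by
        rcases s with t | d <;> simp only [Sum.elim_inl, Sum.elim_inr] <;> fun_prop)
  exact isSetOfReals_of_isEmbedding
    (h1.comp ((IsEmbedding.piMap fun i => IsEmbedding.subtypeVal (p := (· ∈ A i))).prodMap he))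

end Reals

/-! ### Induction on the number of towers -/

theorem sOneGamGam_pi_prod {κ : Ordinal.{0}}
    (hprod : ∀ (A : Type) [TopologicalSpace A], IsSetOfReals A → (#A).ord < κ →
      ProductivelySOneGamGam A)
    {Y : Type} [TopologicalSpace Y] (hYreal : IsSetOfReals Y) (hY : GerlitsNagy Y) {m : ℕ}
    {X : Fin m → Set (Set ℕ)} (hX : ∀ i, IsGeneralizedTower κ (X i)) :
    SOneGamGam ((∀ i, towerSet (X i)) × Y) := by
  obtain ⟨f, hf⟩ := hYreal.exists_isEmbedding
  have : T1Space Y := hf.t1Space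
  induction m with
  | zero => exact (seqSelOne_of_selOn hX hY fun i => i.elim0).sOneGamGam
  | succ m ih =>
    refine (seqSelOne_of_selOn hX hY fun i S hS hcard => ?_).sOneGamGam
    have hmem : ∀ c ∈ toCantor '' S, c ∈ towerSet (X i) := fun c hc =>
      image_mono (hS.trans subset_union_left) hc
    have hsel := (hprod (toCantor '' S) (isSetOfReals_subtype_cantor _)
      ((Cardinal.ord_le_ord.2 Cardinal.mk_image_le).trans_lt hcard) _
      (isSetOfReals_pi_prod (fun l => towerSet (X (i.succAbove l))) hYreal hY)
      (ih fun l => hX (i.succAbove l))).seqSelOne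
    -- Reinserting coordinate `i` maps the smaller product onto the points whose `i`-th coordinate
    -- lies in `S`.
    let g : (toCantor '' S) × ((∀ l, towerSet (X (i.succAbove l))) × Y) →
        (∀ l, towerSet (X l)) × Y :=
      fun q => (i.insertNth (α := fun l => towerSet (X l)) ⟨q.1, hmem _ q.1.2⟩ q.2.1, q.2.2)
    have hg : Continuous g := Continuous.prodMk
      (Continuous.finInsertNth i (Continuous.subtype_mk (by fun_prop) _) (by fun_prop))
      (by fun_prop)
    convert hsel.selOn_range hg using 1
    ext p
    constructor
    · intro hp
      refine ⟨(⟨p.1 i, hp⟩, (fun l => p.1 (i.succAbove l), p.2)), Prod.ext ?_ rfl⟩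
      exact Fin.insertNth_self_removeNth i p.1
    · rintro ⟨q, rfl⟩
      simpa only [g, mem_ofPred_eq, Fin.insertNth_apply_same] using q.1.2

end GenTower

theorem mainTheorem4 (κ : Ordinal.{0}) (hκ : Cardinal.aleph0 < κ.card)
    (hprod : ∀ (A : Type) [TopologicalSpace A], GenTower.IsSetOfReals A →
      (Cardinal.mk A).ord < κ → GenTower.ProductivelySOneGamGam A)
    (m : ℕ) (X : Fin m → Set (Set ℕ)) (hX : ∀ i, GenTower.IsGeneralizedTower κ (X i))
    (Y : Type) [TopologicalSpace Y] (hYreal : GenTower.IsSetOfReals Y)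
    (hY : GenTower.GerlitsNagy Y) :
    GenTower.SOneGamGam (((i : Fin m) → GenTower.towerSet (X i)) × Y) :=
  GenTower.sOneGamGam_pi_prod hprod hYreal hY hX
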